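/- For integers $k \ge 1$, $n \ge 1$, the $k\times n$ grid graph has as vertices the integer points $(x,y)$ with $0\le x<n$, $0\le y<k$, two points being adjacent when they are at distance $1$. A Greek key tour on it is a walk (regarded as directed, and identified with its sequence of vertices) that starts in the upper-left corner $(0,k-1)$, never visits a vertex twice, has a trapped endpoint (every neighbour of the endpoint has been visited), and visits every vertex. Let $g_{k,n}$ be the number of Greek key tours on the $k\times n$ grid graph, put $g_{k,0}=1$ (the empty tour), and let $G_k(x)=\sum_{n\ge 0} g_{k,n}x^n$. Then, as formal power series, \[ G_4(x)=\frac{1-2x-2x^2+11x^3+4x^4-10x^5+4x^6+2x^7-3x^8+x^9}{(1-x-3x^2-x^3+x^4)(1-2x-2x^2+2x^3-x^4)}. \] In particular, the sequence $a(n)=g_{4,n}$ (OEIS A046995) satisfies, for all $n\ge 10$, the linear recurrence \[ a(n)=3a(n-1)+3a(n-2)-9a(n-3)-6a(n-4)+5a(n-5)+a(n-6)-3a(n-7)+a(n-8). \] -/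

import Mathlib

namespace GreekKey

open SimpleGraph

/-- The finite grid graph on the points `(x, y)` with `0 ≤ x < n` and `0 ≤ y < k`
(height `k`, width `n`): two points are adjacent when they are at distance one. -/
def gridGraph (k n : ℕ) : SimpleGraph (Fin n × Fin k) :=
  pathGraph n □ pathGraph k

/-- The upper-left corner `(0, k)` of the grid with height `k + 1` and width `n + 1`. -/
def upperLeft (k n : ℕ) : Fin (n + 1) × Fin (k + 1) :=
  (0, Fin.last k)

/-- A growing self-avoiding walk: a (directed) walk that visits no vertex twice and whose
endpoint is trapped, i.e. all neighbours of the endpoint have been visited. -/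
def IsGSAW {V : Type*} {G : SimpleGraph V} {u v : V} (p : G.Walk u v) : Prop :=
  p.IsPath ∧ ∀ w, G.Adj v w → w ∈ p.support

/-- The Greek key tours on the grid with height `k + 1` and width `n + 1`: the growing
self-avoiding walks that start in the upper-left corner and visit every vertex. The endpoint is
arbitrary, so it is the first component of a dependent pair. -/
def greekKeyTours (k n : ℕ) :
    Set (Σ v : Fin (n + 1) × Fin (k + 1), (gridGraph (k + 1) (n + 1)).Walk (upperLeft k n) v) :=
  {p | IsGSAW p.2 ∧ ∀ w, w ∈ p.2.support}

/-- The number of Greek key tours on the `k × n` grid graph. An empty grid has exactly one tour,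
the empty one; this is the convention behind the constant term `1` of the generating function. -/
noncomputable def tourCount : ℕ → ℕ → ℕ
  | k + 1, n + 1 => (greekKeyTours k n).ncard
  | 0, _ => 1
  | _ + 1, 0 => 1

/-- The generating function of Greek key tours of height `k`, as a formal power series. -/
noncomputable def genFun (k : ℕ) : PowerSeries ℚ :=
  PowerSeries.mk fun n => (tourCount k n : ℚ)

end GreekKey

/-!
Close a tour up through an additional outside vertex `0`, so that it becomes a cyclic arrangement of
all vertices, and delete the vertices one at a time, column by column. Deleting `v` from
`a → v → b` leaves an arrangement of the other vertices in which the link `a → b` is forced, so the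
tours are counted by states: lists of forced links, which only involve the frontier. The possible
choices of `a` and `b` depend on the state alone, hence deleting a whole column is a fixed linear
operator on combinations of states. A polynomial in this operator annihilates the initial state, so
the counts satisfy a linear recurrence; a multiple of the recurrence claimed arises in this way, and
the first values remove the extra factor.
-/

namespace GreekKey

section Arrangements

variable {α : Type*}

/-- The pairs of consecutive entries of the sequence `c, L, d`. -/
def links (c d : α) (L : List α) : List (α × α) :=
  (c :: L).zip (L ++ [d])

theorem map_fst_links (c d : α) (L : List α) : (links c d L).map Prod.fst = c :: L :=
  List.map_fst_zip (by simp)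

theorem map_snd_links (c d : α) (L : List α) : (links c d L).map Prod.snd = L ++ [d] :=
  List.map_snd_zip (by simp)

theorem links_map {β : Type*} (g : α → β) (c d : α) (L : List α) :
    links (g c) (g d) (L.map g) = (links c d L).map (Prod.map g g) := by
  rw [links, links, ← List.map_cons, ← List.map_singleton, ← List.map_append, List.zip_map]

theorem links_append (c d : α) (A B : List α) :
    links c d (A ++ B) =
      (c :: A).zip A ++ (A.getLastD c, B.headD d) :: B.zip (B.tail ++ [d]) := by
  induction A generalizing c with
  | nil => cases B <;> simp [links]
  | cons x A ih =>
    rw [List.getLastD_cons, List.zip_cons_cons, List.cons_append, List.cons_append, ← ih]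
    rfl

theorem links_append_cons (c d v : α) (A B : List α) :
    links c d (A ++ v :: B) =
      (c :: A).zip A ++ (A.getLastD c, v) :: (v, B.headD d) :: B.zip (B.tail ++ [d]) := by
  rw [links_append]
  exact congrArg (fun M => _ ++ _ :: M) (links_append v d [] B)

/-- The links of `A ++ B` that do not cross the cut between `A` and `B`. -/
def otherLinks (c d : α) (A B : List α) : Set (α × α) :=
  {e | e ∈ (c :: A).zip A ++ B.zip (B.tail ++ [d])}

theorem setOf_mem_links_append (c d : α) (A B : List α) :
    {e | e ∈ links c d (A ++ B)} =
      insert (A.getLastD c, B.headD d) (otherLinks c d A B) := by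
  ext e
  simp only [links_append, otherLinks, List.mem_append, List.mem_cons, Set.mem_insert_iff,
    Set.mem_ofPred_eq]
  tauto

theorem setOf_mem_links_append_cons (c d v : α) (A B : List α) :
    {e | e ∈ links c d (A ++ v :: B)} =
      insert (A.getLastD c, v) (insert (v, B.headD d) (otherLinks c d A B)) := by
  ext e
  simp only [links_append_cons, otherLinks, List.mem_append, List.mem_cons, Set.mem_insert_iff,
    Set.mem_ofPred_eq]
  tauto

theorem otherLinks_disjoint {c d v : α} {A B : List α} (hc : (c :: (A ++ v :: B)).Nodup)
    (hd : (d :: (A ++ v :: B)).Nodup) :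
    A.getLastD c ≠ v ∧ B.headD d ≠ v ∧ ∀ e ∈ otherLinks c d A B,
      e.1 ≠ A.getLastD c ∧ e.1 ≠ v ∧ e.2 ≠ B.headD d ∧ e.2 ≠ v := by
  have hfst : ((links c d (A ++ v :: B)).map Prod.fst).Nodup := by rwa [map_fst_links]
  have hsnd : ((links c d (A ++ v :: B)).map Prod.snd).Nodup := by
    rw [map_snd_links]
    exact (List.perm_append_singleton d _).nodup_iff.2 hd
  rw [links_append_cons, List.map_append, List.map_cons, List.map_cons] at hfst hsnd
  refine ⟨by grind, by grind, fun e he => ?_⟩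
  have he1 := List.mem_map_of_mem (f := Prod.fst) he
  have he2 := List.mem_map_of_mem (f := Prod.snd) he
  rw [List.map_append] at he1 he2
  grind

theorem exists_append_of_mem_links {c d : α} {L : List α} {e : α × α} (he : e ∈ links c d L) :
    ∃ A B, L = A ++ B ∧ (A.getLastD c, B.headD d) = e := by
  induction L generalizing c with
  | nil => exact ⟨[], [], rfl, (List.mem_singleton.1 he).symm⟩
  | cons x L ih =>
    rcases List.mem_cons.1 he with rfl | he
    · exact ⟨[], x :: L, rfl, rfl⟩
    · obtain ⟨A, B, rfl, hAB⟩ := ih he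
      exact ⟨x :: A, B, rfl, by rw [List.getLastD_cons, hAB]⟩

theorem headD_mem_cons (B : List α) (d : α) : B.headD d ∈ d :: B := by
  cases B <;> simp

theorem append_inj_of_getLastD_eq {c : α} {A A' B B' : List α} (hd : (c :: (A ++ B)).Nodup)
    (h : A ++ B = A' ++ B') (hlast : A.getLastD c = A'.getLastD c) : A = A' ∧ B = B' := by
  have getLastD_ne {c x : α} {T U : List α} (hd : (c :: (x :: T ++ U)).Nodup) :
      (x :: T).getLastD c ≠ c := by
    rw [List.getLastD_cons]
    have hmem := List.getLastD_mem_cons (l := T) (a := x)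
    grind
  induction A generalizing c A' with
  | nil =>
    cases A' with
    | nil => exact ⟨rfl, h⟩
    | cons x T => exact absurd hlast.symm (getLastD_ne (h ▸ hd))
  | cons x A ih =>
    cases A' with
    | nil => exact absurd hlast (getLastD_ne hd)
    | cons y T =>
      rw [List.cons_append, List.cons_append, List.cons.injEq] at h
      obtain ⟨rfl, h⟩ := h
      rw [List.getLastD_cons, List.getLastD_cons] at hlast
      obtain ⟨rfl, rfl⟩ := ih (List.nodup_cons.1 hd).2 h hlast
      exact ⟨rfl, rfl⟩

/-- The rearrangements `L` of `l` for which the sequence `c, L, d` contains all the forced links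
`F` and only allowed links `A`. -/
def arrangements (F A : Set (α × α)) (c d : α) (l : List α) : Set (List α) :=
  {L | L.Perm l ∧ F ⊆ {e | e ∈ links c d L} ∧ {e | e ∈ links c d L} ⊆ A}

theorem finite_arrangements (F A : Set (α × α)) (c d : α) (l : List α) :
    (arrangements F A c d l).Finite :=
  l.permutations.finite_toSet.subset fun _ hL => List.mem_permutations.2 hL.1

theorem mem_arrangements_nil {F S : Set (α × α)} {c d : α} {L : List α} :
    L ∈ arrangements F S c d [] ↔ L = [] ∧ F ⊆ {(c, d)} ∧ (c, d) ∈ S := by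
  refine and_congr_left' List.perm_nil |>.trans (and_congr_right ?_)
  rintro rfl
  simp [links]

theorem ncard_arrangements_map {β : Type*} {g : α → β} (hg : Function.Injective g)
    (F : Set (α × α)) (A : Set (β × β)) (c d : α) (l : List α) :
    (arrangements (Prod.map g g '' F) A (g c) (g d) (l.map g)).ncard =
      (arrangements F (Prod.map g g ⁻¹' A) c d l).ncard := by
  have hG : Function.Injective (Prod.map g g) := hg.prodMap hg
  have mem_iff (L : List α) : L.map g ∈ arrangements (Prod.map g g '' F) A (g c) (g d) (l.map g) ↔
      L ∈ arrangements F (Prod.map g g ⁻¹' A) c d l := by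
    have hlinks : {e | e ∈ links (g c) (g d) (L.map g)} =
        Prod.map g g '' {e | e ∈ links c d L} := by
      ext e
      simp only [links_map, List.mem_map, Set.mem_ofPred_eq, Set.mem_image]
    simp only [arrangements, Set.mem_ofPred_eq]
    rw [hlinks, List.map_perm_map_iff hg, Set.image_subset_image_iff hG, Set.image_subset_iff]
  rw [← Set.ncard_image_of_injective _ (List.map_injective_iff.2 hg)]
  congr 1
  ext L
  constructor
  · intro hL
    obtain ⟨L, rfl⟩ : L ∈ Set.range (List.map g) := by
      rw [Set.range_list_map]
      intro x hx
      obtain ⟨y, -, rfl⟩ := List.mem_map.1 (hL.1.mem_iff.1 hx)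
      exact ⟨y, rfl⟩
    exact ⟨L, (mem_iff L).1 hL, rfl⟩
  · rintro ⟨L, hL, rfl⟩
    exact (mem_iff L).2 hL

theorem arrangements_eq_empty_of_loop {F A : Set (α × α)} {c d a : α} {l : List α}
    (hc : (c :: l).Nodup) (hd : (d :: l).Nodup) (hl : l ≠ [])
    (ha : (a, a) ∈ F) : arrangements F A c d l = ∅ := by
  refine Set.eq_empty_of_forall_notMem fun L hL => ?_
  obtain ⟨X, Y, rfl, hXY⟩ := exists_append_of_mem_links (hL.2.1 ha)
  have hc' := (hL.1.cons c).nodup_iff.2 hc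
  have hd' := (hL.1.cons d).nodup_iff.2 hd
  have h1 := List.getLastD_mem_cons (l := X) (a := c)
  have h2 := headD_mem_cons Y d
  rw [Prod.mk.injEq] at hXY
  rw [hXY.1] at h1
  rw [hXY.2] at h2
  have hXY' : X ++ Y ≠ [] := fun h => hl (List.nil_perm.1 (h ▸ hL.1))
  cases X <;> cases Y <;> grind

/-- What a set of forced or allowed links becomes when `v` is deleted and its two links are replaced
by the single link `e`. -/
def bypass (F : Set (α × α)) (v : α) (e : α × α) : Set (α × α) :=
  insert e {g ∈ F | g.1 ≠ v ∧ g.2 ≠ v}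

/-- The link from `a` to `v` is allowed, and consistent with the forced links `F`. -/
def IsEntry (F A : Set (α × α)) (v a : α) : Prop :=
  a ≠ v ∧ (a, v) ∈ A ∧ ∀ g ∈ F, g.1 = a ↔ g.2 = v

/-- The link from `v` to `b` is allowed, and consistent with the forced links `F`. -/
def IsExit (F A : Set (α × α)) (v b : α) : Prop :=
  b ≠ v ∧ (v, b) ∈ A ∧ ∀ g ∈ F, g.2 = b ↔ g.1 = v

theorem subset_insert_insert_iff_bypass {F A O : Set (α × α)} {v a b : α} (ha : a ≠ v)
    (hb : b ≠ v) (hO : ∀ e ∈ O, e.1 ≠ a ∧ e.1 ≠ v ∧ e.2 ≠ b ∧ e.2 ≠ v) :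
    F ⊆ insert (a, v) (insert (v, b) O) ∧ insert (a, v) (insert (v, b) O) ⊆ A ↔
      (IsEntry F A v a ∧ IsExit F A v b) ∧
        bypass F v (a, b) ⊆ insert (a, b) O ∧ insert (a, b) O ⊆ bypass A v (a, b) := by
  simp only [IsEntry, IsExit, bypass, Set.subset_def, Set.mem_insert_iff, Set.mem_ofPred_eq]
  constructor
  · rintro ⟨h1, h2⟩
    grind
  · grind

theorem insert_mem_arrangements_iff {F S : Set (α × α)} {c d v : α} {l A B : List α}
    (hc : (c :: v :: l).Nodup) (hd : (d :: v :: l).Nodup) :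
    A ++ v :: B ∈ arrangements F S c d (v :: l) ↔
      (IsEntry F S v (A.getLastD c) ∧ IsExit F S v (B.headD d)) ∧
        A ++ B ∈ arrangements (bypass F v (A.getLastD c, B.headD d))
          (bypass S v (A.getLastD c, B.headD d)) c d l := by
  have hperm : (A ++ v :: B).Perm (v :: l) ↔ (A ++ B).Perm l := by
    rw [← List.perm_cons v (l₁ := A ++ B)]
    exact List.perm_middle.congr_left _
  by_cases hl : (A ++ B).Perm l
  swap
  · exact iff_of_false (fun h => hl (hperm.1 h.1)) fun h => hl h.2.1
  obtain ⟨hne_last, hne_head, hdisj⟩ := otherLinks_disjoint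
    (((hperm.2 hl).cons c).nodup_iff.2 hc) (((hperm.2 hl).cons d).nodup_iff.2 hd)
  simp only [arrangements, Set.mem_ofPred_eq, hperm, hl, true_and]
  rw [setOf_mem_links_append_cons, setOf_mem_links_append]
  exact subset_insert_insert_iff_bypass hne_last hne_head hdisj

/-- The ways of cutting a member of `X` in two along the link `e`. -/
def cuts (c d : α) (e : α × α) (X : Set (List α)) : Set (List α × List α) :=
  {p | p.1 ++ p.2 ∈ X ∧ (p.1.getLastD c, p.2.headD d) = e}

theorem bijOn_cuts {F S : Set (α × α)} {c d : α} {e : α × α} {l : List α} (he : e ∈ F)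
    (hc : (c :: l).Nodup) :
    Set.BijOn (fun p => p.1 ++ p.2) (cuts c d e (arrangements F S c d l))
      (arrangements F S c d l) := by
  refine ⟨fun p hp => hp.1, ?_, ?_⟩
  · rintro ⟨A, B⟩ ⟨hp, hpe⟩ ⟨A', B'⟩ ⟨-, hpe'⟩ h
    have hd : (c :: (A ++ B)).Nodup := (hp.1.cons c).nodup_iff.2 hc
    obtain ⟨rfl, rfl⟩ := append_inj_of_getLastD_eq hd h
      ((congrArg Prod.fst hpe).trans (congrArg Prod.fst hpe').symm)
    rfl
  · intro L hL
    obtain ⟨A, B, rfl, hAB⟩ := exists_append_of_mem_links (hL.2.1 he)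
    exact ⟨(A, B), ⟨hL, hAB⟩, rfl⟩

theorem arrangements_cons {F S : Set (α × α)} {c d v : α} {l : List α}
    (hc : (c :: v :: l).Nodup) (hd : (d :: v :: l).Nodup) :
    arrangements F S c d (v :: l) =
      ⋃ e ∈ {e : α × α | IsEntry F S v e.1 ∧ IsExit F S v e.2},
        (fun p => p.1 ++ v :: p.2) ''
          cuts c d e (arrangements (bypass F v e) (bypass S v e) c d l) := by
  ext L
  simp only [Set.mem_iUnion, Set.mem_image, exists_prop]
  constructor
  · intro hL
    obtain ⟨A, B, rfl⟩ := List.append_of_mem (hL.1.mem_iff.2 List.mem_cons_self)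
    obtain ⟨hae, hmem⟩ := (insert_mem_arrangements_iff hc hd).1 hL
    exact ⟨(A.getLastD c, B.headD d), hae, (A, B), ⟨hmem, rfl⟩, rfl⟩
  · rintro ⟨e, hae, ⟨A, B⟩, ⟨hmem, rfl⟩, rfl⟩
    exact (insert_mem_arrangements_iff hc hd).2 ⟨hae, hmem⟩

theorem ncard_arrangements_cons {F S : Set (α × α)} {c d v : α} {l : List α}
    (hc : (c :: v :: l).Nodup) (hd : (d :: v :: l).Nodup) {E : List (α × α)} (hE : E.Nodup)
    (mem_E : ∀ e, e ∈ E ↔ IsEntry F S v e.1 ∧ IsExit F S v e.2) :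
    (arrangements F S c d (v :: l)).ncard =
      (E.map fun e => (arrangements (bypass F v e) (bypass S v e) c d l).ncard).sum := by
  classical
  set X := fun e => arrangements (bypass F v e) (bypass S v e) c d l
  set ins : List α × List α → List α := fun p => p.1 ++ v :: p.2
  have notMem {e : α × α} {p : List α × List α} (hp : p ∈ cuts c d e (X e)) : v ∉ p.1 ++ p.2 :=
    fun h => (List.nodup_cons.1 (List.nodup_cons.1 hc).2).1 (hp.1.1.mem_iff.1 h)
  have ins_inj {e : α × α} {p q : List α × List α} (hp : p ∈ cuts c d e (X e))
      (h : ins p = ins q) : p = q := by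
    have hvp := notMem hp
    rw [List.mem_append, not_or] at hvp
    obtain ⟨h1, -, h2⟩ := (List.append_cons_inj_of_notMem hvp.1 hvp.2).1 h
    exact Prod.ext h1 h2
  have hcl : (c :: l).Nodup := hc.sublist ((List.sublist_cons_self v l).cons_cons c)
  have hcut (e : α × α) : Set.BijOn (fun p => p.1 ++ p.2) (cuts c d e (X e)) (X e) :=
    bijOn_cuts (Set.mem_insert _ _) hcl
  have hcard (e : α × α) : (ins '' cuts c d e (X e)).ncard = (X e).ncard :=
    (Set.InjOn.ncard_image fun p hp q _ => ins_inj hp).trans (hcut e).ncard_eq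
  have hmem : {e : α × α | IsEntry F S v e.1 ∧ IsExit F S v e.2} = ↑E.toFinset := by
    ext e
    simp [mem_E]
  rw [arrangements_cons hc hd, hmem, Set.Finite.ncard_biUnion, finsum_mem_coe_finset,
    List.sum_toFinset _ hE]
  · exact congrArg List.sum (List.map_congr_left fun e _ => hcard e)
  · exact E.toFinset.finite_toSet
  · exact fun e _ => ((hcut e).finite_iff_finite.2 (finite_arrangements _ _ _ _ _)).image _
  · rintro e - e' - hne
    rw [Function.onFun, Set.disjoint_left]
    rintro _ ⟨p, hp, rfl⟩ ⟨q, hq, h⟩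
    obtain rfl := ins_inj hq h
    exact hne (hp.2.symm.trans hq.2)

end Arrangements

theorem sum_map_filter_of_eq_zero {σ M : Type*} [AddMonoid M] {p : σ → Prop} [DecidablePred p]
    {φ : σ → M} (hφ : ∀ x, ¬ p x → φ x = 0) (l : List σ) :
    ((l.filter p).map φ).sum = (l.map φ).sum := by
  induction l with
  | nil => rfl
  | cons x l ih => by_cases hx : p x <;> simp [hx, hφ, ih]

section GridLinks

/-- The vertex labelled `y` is right of or below the vertex labelled `x`, in a grid of height `h`
of which the first columnwise vertices have been deleted and the remaining `m` are labelled
`1, …, m`. Counting from the end, the last vertex of a column is one with `h ∣ m - x`. -/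
def Follows (h m x y : ℕ) : Prop :=
  y = x + h ∨ y = x + 1 ∧ ¬ h ∣ m - x

/-- The links that a tour may use; the outside vertex `0` closes it up and may follow any vertex. -/
def gridLinks (h m : ℕ) : Set (ℕ × ℕ) :=
  {e | e.1 ≠ 0 ∧ (e.2 = 0 ∨ Follows h m e.1 e.2 ∨ Follows h m e.2 e.1)}

/-- Undoes the relabelling after the deletion of vertex `1`: all vertices but the outside vertex `0`
move up by one. -/
def raise (x : ℕ) : ℕ :=
  if x = 0 then 0 else x + 1

theorem raise_injective : Function.Injective raise := by
  intro x y h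
  unfold raise at h
  grind

theorem raise_ne_one (x : ℕ) : raise x ≠ 1 := by
  unfold raise
  grind

theorem raise_pred {x : ℕ} (hx : x ≠ 1) : raise (x - 1) = x := by
  unfold raise
  grind

theorem range'_one_succ (m : ℕ) : List.range' 1 (m + 1) = 1 :: (List.range' 1 m).map raise := by
  rw [List.range'_succ, Nat.add_comm, ← List.map_add_range']
  refine congrArg _ (List.map_congr_left fun x hx => ?_)
  rw [raise, if_neg (by grind), Nat.add_comm]

theorem follows_succ_succ (h m x y : ℕ) : Follows h (m + 1) (x + 1) (y + 1) ↔ Follows h m x y := by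
  simp only [Follows, Nat.add_sub_add_right]
  grind

theorem preimage_raise_gridLinks (h m : ℕ) :
    Prod.map raise raise ⁻¹' gridLinks h (m + 1) = gridLinks h m := by
  ext ⟨x, y⟩
  rcases Nat.eq_zero_or_pos x with rfl | hx
  · simp [gridLinks, raise]
  rcases Nat.eq_zero_or_pos y with rfl | hy
  · simp [gridLinks, raise]
  · simp [gridLinks, raise, hx.ne', hy.ne', follows_succ_succ]

end GridLinks

section Transfer

/-- A pair of vertex labels, the second of which follows the first in a tour. -/
abbrev Link := ℕ × ℕ

/-- The forced links in a partially deleted grid. In the full grid the state `[(0, 1)]` requires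
tours to start in the upper-left corner, vertex `1`. -/
abbrev State := List Link

/-- The orders in which the remaining `m` vertices can be visited, starting and ending at the
outside vertex `0` and using the forced links `f`. -/
def orderings (h m : ℕ) (f : State) : Set (List ℕ) :=
  arrangements {e | e ∈ f} ({e | e ∈ f} ∪ gridLinks h m) 0 0 (List.range' 1 m)

/-- The number of completions of the state `f`. -/
noncomputable def count (h m : ℕ) (f : State) : ℕ :=
  (orderings h m f).ncard

/-- The possible predecessors of vertex `1`, where `p` tells whether `2` lies below `1`. -/
def entries (h : ℕ) (p : Bool) (f : State) : List ℕ :=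
  ((f.filter fun g => g.2 = 1).map Prod.fst ∪ ((if p then [2] else []) ∪ [h + 1])).filter
    fun a => a ≠ 1 ∧ ∀ g ∈ f, g.1 = a ↔ g.2 = 1

/-- The possible successors of vertex `1`, where `p` tells whether `2` lies below `1`. -/
def exits (h : ℕ) (p : Bool) (f : State) : List ℕ :=
  ((f.filter fun g => g.1 = 1).map Prod.snd ∪ ((if p then [0, 2] else [0]) ∪ [h + 1])).filter
    fun b => b ≠ 1 ∧ ∀ g ∈ f, g.2 = b ↔ g.1 = 1

/-- The state after vertex `1` is deleted and its two links are replaced by `e`. Sorting makes equal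
sets of forced links equal as lists. -/
def contract (f : State) (e : Link) : State :=
  ((e :: f.filter fun g => g.1 ≠ 1 ∧ g.2 ≠ 1).map
    fun g => (g.1 - 1, g.2 - 1)).insertionSort fun d e => d.1 ≤ e.1

/-- A cheap necessary condition for a state to have completions: a forced link from a vertex to
itself can only be the loop at `0` of the empty tour. -/
def Viable (f : State) : Prop :=
  (∀ e ∈ f, e = (0, 0)) ∨ ∀ e ∈ f, e.1 ≠ e.2

instance : DecidablePred Viable :=
  fun _ => inferInstanceAs (Decidable (_ ∨ _))

/-- The states that can arise by deleting vertex `1`, where `p` tells whether `2` lies below `1`. -/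
def successors (h : ℕ) (p : Bool) (f : State) : List State :=
  ((entries h p f ×ˢ exits h p f).map (contract f)).filter Viable

theorem mem_entries {h m : ℕ} {f : State} {a : ℕ} :
    a ∈ entries h (¬ h ∣ m) f ↔
      IsEntry {e | e ∈ f} ({e | e ∈ f} ∪ gridLinks h (m + 1)) 1 a := by
  have hgrid (ha : a ≠ 1) :
      (a, 1) ∈ gridLinks h (m + 1) ↔ a = h + 1 ∨ a = 2 ∧ ¬ h ∣ m := by
    simp only [gridLinks, Follows, Set.mem_ofPred_eq]
    grind
  have hforced : a ∈ (f.filter fun g => g.2 = 1).map Prod.fst ↔ (a, 1) ∈ f := by simp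
  simp only [entries, IsEntry, hforced, List.mem_filter, List.mem_union_iff, decide_eq_true_eq,
    Set.mem_union, Set.mem_ofPred_eq]
  grind

theorem mem_exits {h m : ℕ} {f : State} {b : ℕ} :
    b ∈ exits h (¬ h ∣ m) f ↔
      IsExit {e | e ∈ f} ({e | e ∈ f} ∪ gridLinks h (m + 1)) 1 b := by
  have hgrid (hb : b ≠ 1) :
      (1, b) ∈ gridLinks h (m + 1) ↔ b = 0 ∨ b = h + 1 ∨ b = 2 ∧ ¬ h ∣ m := by
    simp only [gridLinks, Follows, Set.mem_ofPred_eq]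
    grind
  have hforced : b ∈ (f.filter fun g => g.1 = 1).map Prod.snd ↔ (1, b) ∈ f := by simp
  simp only [exits, IsExit, hforced, List.mem_filter, List.mem_union_iff, decide_eq_true_eq,
    Set.mem_union, Set.mem_ofPred_eq]
  grind

theorem nodup_entries_product_exits (h : ℕ) (p : Bool) (f : State) :
    (entries h p f ×ˢ exits h p f).Nodup :=
  (((List.nodup_singleton _).union _).union _ |>.filter _).product
    (((List.nodup_singleton _).union _).union _ |>.filter _)

theorem image_raise_contract {f : State} {e : Link} (h1 : e.1 ≠ 1) (h2 : e.2 ≠ 1) :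
    Prod.map raise raise '' {g | g ∈ contract f e} = bypass {g | g ∈ f} 1 e := by
  have hcontract : {g | g ∈ contract f e} =
      (fun g : Link => (g.1 - 1, g.2 - 1)) '' bypass {g | g ∈ f} 1 e := by
    ext g
    simp [contract, bypass, eq_comm (a := g)]
  rw [hcontract, Set.image_image]
  refine (Set.image_congr fun g hg => ?_).trans (Set.image_id' _)
  have hg : g.1 ≠ 1 ∧ g.2 ≠ 1 := by
    rcases hg with rfl | hg
    exacts [⟨h1, h2⟩, hg.2]
  exact Prod.ext (raise_pred hg.1) (raise_pred hg.2)

theorem preimage_raise_bypass {f : State} {e : Link} (h1 : e.1 ≠ 1) (h2 : e.2 ≠ 1) (h m : ℕ) :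
    Prod.map raise raise ⁻¹' bypass ({g | g ∈ f} ∪ gridLinks h (m + 1)) 1 e =
      {g | g ∈ contract f e} ∪ gridLinks h m := by
  have hinj : Function.Injective (Prod.map raise raise) := raise_injective.prodMap raise_injective
  rw [← preimage_raise_gridLinks h m, ← Set.preimage_image_eq {g | g ∈ contract f e} hinj,
    image_raise_contract h1 h2, ← Set.preimage_union]
  ext g
  have h1 := raise_ne_one g.1
  have h2 := raise_ne_one g.2
  simp only [bypass, Set.mem_preimage, Set.mem_union, Set.mem_insert_iff, Set.mem_ofPred_eq,
    Prod.map]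
  tauto

theorem ncard_arrangements_bypass {f : State} {e : Link} (h1 : e.1 ≠ 1) (h2 : e.2 ≠ 1) (h m : ℕ) :
    (arrangements (bypass {g | g ∈ f} 1 e) (bypass ({g | g ∈ f} ∪ gridLinks h (m + 1)) 1 e) 0 0
      ((List.range' 1 m).map raise)).ncard = count h m (contract f e) := by
  rw [count, orderings, ← preimage_raise_bypass h1 h2, ← image_raise_contract h1 h2]
  exact ncard_arrangements_map raise_injective _ _ 0 0 _

theorem nodup_zero_cons_range'_one (m : ℕ) : (0 :: List.range' 1 m).Nodup :=
  List.nodup_range' (s := 0) (n := m + 1)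

theorem count_zero (h : ℕ) (f : State) :
    count h 0 f = if (0, 0) ∈ f ∧ ∀ e ∈ f, e = (0, 0) then 1 else 0 := by
  have hmem (L : List ℕ) : L ∈ arrangements {e | e ∈ f} ({e | e ∈ f} ∪ gridLinks h 0) 0 0 [] ↔
      L = [] ∧ (0, 0) ∈ f ∧ ∀ e ∈ f, e = (0, 0) := by
    simp [mem_arrangements_nil, gridLinks, Set.subset_def, and_comm]
  rw [count, orderings, List.range'_zero]
  split_ifs with hf
  · rw [Set.ncard_eq_one]
    exact ⟨[], Set.ext fun L => (hmem L).trans (and_iff_left hf)⟩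
  · rw [Set.ncard_eq_zero (finite_arrangements _ _ _ _ _)]
    exact Set.eq_empty_of_forall_notMem fun L hL => hf ((hmem L).1 hL).2

theorem count_eq_zero_of_not_viable {f : State} (hf : ¬ Viable f) (h m : ℕ) : count h m f = 0 := by
  rw [Viable, not_or] at hf
  rcases Nat.eq_zero_or_pos m with rfl | hm
  · rw [count_zero, if_neg fun hall => hf.1 hall.2]
  · obtain ⟨⟨a, b⟩, hab, rfl : a = b⟩ : ∃ e ∈ f, e.1 = e.2 := by simpa using hf.2
    have hnodup : (0 :: List.range' 1 m).Nodup := nodup_zero_cons_range'_one m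
    rw [count, orderings, arrangements_eq_empty_of_loop hnodup hnodup (by simpa using hm.ne') hab,
      Set.ncard_empty]

theorem count_succ (h m : ℕ) (f : State) :
    count h (m + 1) f = ((successors h (¬ h ∣ m) f).map (count h m)).sum := by
  have hnodup := nodup_zero_cons_range'_one (m + 1)
  have hlinks := nodup_entries_product_exits h (¬ h ∣ m) f
  rw [range'_one_succ] at hnodup
  rw [count, orderings, range'_one_succ, ncard_arrangements_cons hnodup hnodup hlinks fun e => by
    rw [List.mem_product, mem_entries, mem_exits]]
  rw [successors, sum_map_filter_of_eq_zero fun f hf => count_eq_zero_of_not_viable hf h m,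
    List.map_map]
  refine congrArg List.sum (List.map_congr_left fun e he => ?_)
  rw [List.mem_product, mem_entries (m := m), mem_exits (m := m)] at he
  exact ncard_arrangements_bypass he.1.1 he.2.1 h m

/-- The states that can arise by deleting the last `j` vertices of a column. -/
def colSuccessors (h : ℕ) : ℕ → State → List State
  | 0, f => [f]
  | j + 1, f => (successors h (j ≠ 0) f).flatMap (colSuccessors h j)

theorem count_mul_add (h n : ℕ) {j : ℕ} (hj : j ≤ h) (f : State) :
    count h (h * n + j) f = ((colSuccessors h j f).map (count h (h * n))).sum := by
  induction j generalizing f with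
  | zero => simp [colSuccessors]
  | succ j ih =>
    have hdvd : ¬ h ∣ h * n + j ↔ j ≠ 0 := by
      rw [Nat.dvd_add_right (dvd_mul_right h n)]
      exact ⟨fun hn h0 => hn (h0 ▸ dvd_zero h),
        fun h0 => Nat.not_dvd_of_pos_of_lt (Nat.pos_of_ne_zero h0) hj⟩
    rw [← Nat.add_assoc, count_succ, colSuccessors, List.map_flatMap, List.flatMap_def,
      List.sum_flatten, List.map_map]
    simp only [hdvd]
    exact congrArg List.sum (List.map_congr_left fun g _ => ih (Nat.le_of_succ_le hj) g)

theorem cast_count_column (h n : ℕ) (f : State) :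
    (count h (h * (n + 1)) f : ℤ) =
      ((colSuccessors h h f).map fun g => (count h (h * n) g : ℤ)).sum := by
  rw [Nat.mul_succ, count_mul_add h n le_rfl, Nat.cast_list_sum, List.map_map]
  rfl

end Transfer

section Combinations

variable {σ : Type*}

/-- Extends `φ` linearly to integer combinations of states, given as lists of weighted terms. -/
def evalComb (φ : σ → ℤ) (w : List (σ × ℤ)) : ℤ :=
  (w.map fun t => t.2 * φ t.1).sum

@[simp]
theorem evalComb_nil (φ : σ → ℤ) : evalComb φ [] = 0 := rfl

@[simp]
theorem evalComb_cons (φ : σ → ℤ) (t : σ × ℤ) (w : List (σ × ℤ)) :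
    evalComb φ (t :: w) = t.2 * φ t.1 + evalComb φ w := rfl

theorem evalComb_eq_zero (φ : σ → ℤ) {w : List (σ × ℤ)} (hw : ∀ t ∈ w, t.2 = 0) :
    evalComb φ w = 0 :=
  List.sum_eq_zero <| List.forall_mem_map.2 fun t ht => by rw [hw t ht, zero_mul]

variable [DecidableEq σ]

/-- The combination `c • x + w`, with the terms in the same state collected. -/
def addTerm (x : σ) (c : ℤ) : List (σ × ℤ) → List (σ × ℤ)
  | [] => [(x, c)]
  | (y, d) :: w => if x = y then (y, c + d) :: w else (y, d) :: addTerm x c w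

/-- The combination `c • v + w`, with the terms in the same state collected. -/
def addScaled (c : ℤ) (v w : List (σ × ℤ)) : List (σ × ℤ) :=
  v.foldr (fun t => addTerm t.1 (c * t.2)) w

/-- The linear operator that sends `x` to the sum of the members of `T x`. -/
def push (T : σ → List σ) (w : List (σ × ℤ)) : List (σ × ℤ) :=
  w.foldr (fun t => addScaled t.2 ((T t.1).map fun y => (y, 1))) []

/-- The image of `w` under a polynomial in the operator `push T`, evaluated by Horner's scheme. Here
and in `applyShift` coefficients are listed from the constant term upwards. -/
def horner (T : σ → List σ) (w : List (σ × ℤ)) : List ℤ → List (σ × ℤ)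
  | [] => []
  | c :: cs => addScaled c w (push T (horner T w cs))

theorem evalComb_addTerm (φ : σ → ℤ) (x : σ) (c : ℤ) (w : List (σ × ℤ)) :
    evalComb φ (addTerm x c w) = c * φ x + evalComb φ w := by
  induction w with
  | nil => rfl
  | cons t w ih =>
    rw [addTerm]
    split_ifs with hx
    · simp only [evalComb_cons, hx]
      ring
    · simp only [evalComb_cons, ih]
      ring

theorem evalComb_addScaled (φ : σ → ℤ) (c : ℤ) (v w : List (σ × ℤ)) :
    evalComb φ (addScaled c v w) = c * evalComb φ v + evalComb φ w := by
  induction v with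
  | nil => simp [addScaled]
  | cons t v ih =>
    rw [addScaled] at ih
    simp only [addScaled, List.foldr_cons, evalComb_addTerm, ih, evalComb_cons]
    ring

theorem evalComb_push (φ : σ → ℤ) (T : σ → List σ) (w : List (σ × ℤ)) :
    evalComb φ (push T w) = evalComb (fun x => ((T x).map φ).sum) w := by
  induction w with
  | nil => rfl
  | cons t w ih =>
    rw [push] at ih
    rw [push, List.foldr_cons, evalComb_addScaled, ih, evalComb_cons]
    simp [evalComb, Function.comp_def]

/-- A polynomial in the shift operator, applied to the sequence `u`. -/
def applyShift : List ℤ → (ℕ → ℤ) → ℕ → ℤ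
  | [], _, _ => 0
  | c :: cs, u, n => c * u n + applyShift cs u (n + 1)

theorem applyShift_concat (cs : List ℤ) (c : ℤ) (u : ℕ → ℤ) (n : ℕ) :
    applyShift (cs ++ [c]) u n = applyShift cs u n + c * u (n + cs.length) := by
  induction cs generalizing n with
  | nil => simp [applyShift]
  | cons d cs ih =>
    rw [List.cons_append, applyShift, ih, applyShift, List.length_cons]
    grind

theorem applyShift_congr {cs : List ℤ} {u v : ℕ → ℤ} {n : ℕ}
    (huv : ∀ i < cs.length, u (n + i) = v (n + i)) : applyShift cs u n = applyShift cs v n := by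
  induction cs generalizing n with
  | nil => rfl
  | cons c cs ih =>
    rw [applyShift, applyShift, ih fun i hi => ?_, show u n = v n from huv 0 (Nat.succ_pos _)]
    rw [Nat.add_right_comm]
    exact huv (i + 1) (Nat.succ_lt_succ hi)

theorem applyShift_zero (cs : List ℤ) (n : ℕ) : applyShift cs 0 n = 0 := by
  induction cs generalizing n with
  | nil => rfl
  | cons c cs ih => simp [applyShift, ih]

theorem eq_zero_of_applyShift_eq_zero {cs : List ℤ} {u : ℕ → ℤ}
    (hrec : ∀ n, applyShift (cs ++ [1]) u n = 0) (hinit : ∀ n < cs.length, u n = 0) (n : ℕ) :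
    u n = 0 := by
  induction n using Nat.strong_induction_on with
  | _ n ih =>
    obtain hn | ⟨m, rfl⟩ := (lt_or_ge n cs.length).imp_right Nat.exists_eq_add_of_le'
    · exact hinit n hn
    · have hm := hrec m
      rw [applyShift_concat, one_mul, applyShift_congr (v := 0) fun i hi => ih _ (by omega),
        applyShift_zero, zero_add] at hm
      exact hm

variable {T : σ → List σ} {φ : ℕ → σ → ℤ}

theorem evalComb_horner (hφ : ∀ n x, φ (n + 1) x = ((T x).map (φ n)).sum) (w : List (σ × ℤ))
    (cs : List ℤ) (n : ℕ) :
    evalComb (φ n) (horner T w cs) = applyShift cs (fun n => evalComb (φ n) w) n := by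
  induction cs generalizing n with
  | nil => rfl
  | cons c cs ih =>
    rw [horner, evalComb_addScaled, evalComb_push, ← funext (hφ n), ih, applyShift]

theorem evalComb_iterate_push (hφ : ∀ n x, φ (n + 1) x = ((T x).map (φ n)).sum)
    (w : List (σ × ℤ)) (n : ℕ) : evalComb (φ 0) ((push T)^[n] w) = evalComb (φ n) w := by
  induction n generalizing w with
  | zero => rfl
  | succ n ih => rw [Function.iterate_succ_apply, ih, evalComb_push, ← funext (hφ n)]

end Combinations

section HeightFour

/-- The recurrence of the theorem: `x ^ 2` times the reciprocal polynomial of the denominator of the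
generating function. The factor `x ^ 2` accounts for the recurrence starting only at `n = 10`. -/
def recurrence : List ℤ := [0, 0, -1, 3, -1, -5, 6, 9, -3, -3, 1]

/-- A polynomial without its leading term `x ^ 7`. Times `recurrence`, it makes a polynomial in the
transfer operator that annihilates the initial state. -/
def cofactor : List ℤ := [1, 0, -5, 4, 4, -5, 0]

/-- The values `count 4 (4 * n) [(0, 1)]` for `n < 17`. -/
def firstCounts : List ℤ :=
  [0, 1, 4, 17, 52, 160, 469, 1337, 3750, 10347, 28249, 76382, 204996, 546651, 1449952,
    3828232, 10067585]

theorem coeff_horner_horner_eq_zero :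
    ∀ t ∈ horner (colSuccessors 4 4) (horner (colSuccessors 4 4) [([(0, 1)], 1)] recurrence)
      (cofactor ++ [1]), t.2 = 0 := by
  decide +kernel

theorem map_evalComb_iterate_push :
    ((List.iterate (push (colSuccessors 4 4)) [([(0, 1)], 1)] 17).map
      (evalComb fun f => if (0, 0) ∈ f ∧ ∀ e ∈ f, e = (0, 0) then 1 else 0)) = firstCounts := by
  decide +kernel

theorem cast_count_four_eq_evalComb (n : ℕ) :
    (count 4 (4 * n) [(0, 1)] : ℤ) =
      evalComb (fun f => (count 4 (4 * n) f : ℤ)) [([(0, 1)], 1)] := by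
  rw [evalComb_cons, evalComb_nil, one_mul, add_zero]

theorem cast_count_four {n : ℕ} (hn : n < firstCounts.length) :
    (count 4 (4 * n) [(0, 1)] : ℤ) = firstCounts[n] := by
  have hφ : (fun f => (count 4 (4 * 0) f : ℤ)) =
      fun f : State => if (0, 0) ∈ f ∧ ∀ e ∈ f, e = (0, 0) then 1 else 0 := by
    funext f
    rw [Nat.mul_zero, count_zero, Nat.cast_ite, Nat.cast_one, Nat.cast_zero]
  rw [cast_count_four_eq_evalComb, ← evalComb_iterate_push
    (φ := fun n f => (count 4 (4 * n) f : ℤ)) (cast_count_column 4), hφ]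
  simp only [← map_evalComb_iterate_push, List.getElem_map, List.getElem_iterate]

theorem applyShift_recurrence_count_four (n : ℕ) :
    applyShift recurrence (fun n => (count 4 (4 * n) [(0, 1)] : ℤ)) n = 0 := by
  refine eq_zero_of_applyShift_eq_zero (cs := cofactor) (fun n => ?_) (fun n hn => ?_) n
  · simp only [cast_count_four_eq_evalComb]
    rw [← funext (evalComb_horner (cast_count_column 4) _ recurrence),
      ← evalComb_horner (cast_count_column 4)]
    exact evalComb_eq_zero _ coeff_horner_horner_eq_zero
  · have hvalue (i : ℕ) (hi : i < recurrence.length) : n + i < firstCounts.length :=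
      lt_of_lt_of_eq (b := 17)
        (by simp only [cofactor, recurrence, List.length] at hn hi; omega) rfl
    rw [applyShift_congr (v := fun n => firstCounts.getD n 0) fun i hi => by
      rw [cast_count_four (hvalue i hi), List.getD_eq_getElem _ _ (hvalue i hi)]]
    have hn : n < 7 := hn
    interval_cases n <;> rfl

end HeightFour

section Tours

open SimpleGraph

variable {k n : ℕ}

/-- Numbers the vertices from 1, column by column, each column from top to bottom. -/
def label (v : Fin (n + 1) × Fin (k + 1)) : ℕ :=
  finProdFinEquiv (v.1, v.2.rev) + 1

theorem label_injective : Function.Injective (label (k := k) (n := n)) := by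
  intro v w h
  have h := finProdFinEquiv.injective (Fin.val_injective (Nat.succ_injective h))
  rw [Prod.mk.injEq, Fin.rev_inj] at h
  exact Prod.ext h.1 h.2

theorem label_eq (v : Fin (n + 1) × Fin (k + 1)) :
    label v = v.2.rev + (k + 1) * v.1 + 1 := rfl

theorem label_upperLeft : label (upperLeft k n) = 1 := by
  rw [label_eq, upperLeft, Fin.rev_last]
  rfl

theorem range_label : Set.range (label (k := k) (n := n)) =
    {x | x ∈ List.range' 1 ((k + 1) * (n + 1))} := by
  ext x
  rw [Set.mem_ofPred_eq, List.mem_range'_1, Nat.mul_comm]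
  constructor
  · rintro ⟨v, rfl⟩
    have := (finProdFinEquiv (v.1, v.2.rev)).isLt
    rw [label]
    omega
  · rintro ⟨h1, h2⟩
    obtain ⟨v, hv⟩ := finProdFinEquiv.surjective (⟨x - 1, by omega⟩ : Fin ((n + 1) * (k + 1)))
    refine ⟨(v.1, v.2.rev), ?_⟩
    rw [label, Fin.rev_rev, hv]
    exact Nat.sub_add_cancel h1

theorem add_mul_inj {c r s x y : ℕ} (hr : r < c) (hs : s < c) :
    r + c * x = s + c * y ↔ r = s ∧ x = y := by
  refine ⟨fun h => ?_, fun h => by rw [h.1, h.2]⟩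
  have hmod := congrArg (· % c) h
  have hdiv := congrArg (· / c) h
  simp only [Nat.add_mul_mod_self_left, Nat.mod_eq_of_lt hr, Nat.mod_eq_of_lt hs] at hmod
  simp only [Nat.add_mul_div_left _ _ (Nat.zero_lt_of_lt hr), Nat.div_eq_of_lt hr,
    Nat.div_eq_of_lt hs, Nat.zero_add] at hdiv
  exact ⟨hmod, hdiv⟩

theorem dvd_sub_label {v : Fin (n + 1) × Fin (k + 1)} :
    k + 1 ∣ (k + 1) * (n + 1) - label v ↔ v.2 = 0 := by
  have hsub : (k + 1) * (n + 1) - label v = v.2 + (k + 1) * (n - v.1) := by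
    have hmul : (k + 1) * (n - v.1) + (k + 1) * v.1 = (k + 1) * n := by
      rw [← Nat.mul_add, Nat.sub_add_cancel (Fin.is_le v.1)]
    have hrev := Fin.rev_add_cast v.2
    rw [label_eq, Nat.mul_succ]
    omega
  rw [hsub, ← Nat.dvd_add_iff_left (dvd_mul_right _ _), Fin.ext_iff]
  exact ⟨fun h => Nat.eq_zero_of_dvd_of_lt h v.2.isLt, fun h => h ▸ dvd_zero _⟩

theorem follows_label_iff {v w : Fin (n + 1) × Fin (k + 1)} :
    Follows (k + 1) ((k + 1) * (n + 1)) (label v) (label w) ↔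
      w.2 = v.2 ∧ v.1.1 + 1 = w.1.1 ∨ w.1 = v.1 ∧ w.2.1 + 1 = v.2.1 := by
  have hright : label w = label v + (k + 1) ↔ w.2 = v.2 ∧ v.1.1 + 1 = w.1.1 := by
    rw [← Fin.rev_inj, Fin.ext_iff, eq_comm (a := v.1.1 + 1),
      ← add_mul_inj w.2.rev.isLt v.2.rev.isLt, label_eq, label_eq]
    grind
  have hbelow (hv : v.2 ≠ 0) : label w = label v + 1 ↔ w.1 = v.1 ∧ w.2.1 + 1 = v.2.1 := by
    have hv0 : v.2.1 ≠ 0 := Fin.val_ne_zero_iff.2 hv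
    have hrev := Fin.val_rev v.2
    have hrev' := Fin.val_rev w.2
    have h := add_mul_inj (x := w.1) (y := v.1) w.2.rev.isLt
      (show v.2.rev.1 + 1 < k + 1 by omega)
    rw [label_eq, label_eq, Fin.ext_iff]
    omega
  rw [Follows, hright, dvd_sub_label]
  refine or_congr_right ?_
  by_cases hv : v.2 = 0
  · simp [hv]
  · rw [hbelow hv, and_iff_left hv]

theorem adj_iff_follows_label {v w : Fin (n + 1) × Fin (k + 1)} :
    (gridGraph (k + 1) (n + 1)).Adj v w ↔
      Follows (k + 1) ((k + 1) * (n + 1)) (label v) (label w) ∨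
      Follows (k + 1) ((k + 1) * (n + 1)) (label w) (label v) := by
  simp only [gridGraph, boxProd_adj, pathGraph_adj, follows_label_iff]
  grind

theorem links_subset_gridLinks_iff {h m x : ℕ} {L : List ℕ} (h0 : 0 ∉ x :: L) :
    (∀ e ∈ links x 0 L, e ∈ {e | e ∈ [(0, 1)]} ∪ gridLinks h m) ↔
      (x :: L).IsChain fun x y => Follows h m x y ∨ Follows h m y x := by
  induction L generalizing x with
  | nil => simpa [links, gridLinks, eq_comm] using h0
  | cons y L ih =>
    rw [List.mem_cons, not_or] at h0
    have hy : y ≠ 0 := fun hy => h0.2 (hy ▸ List.mem_cons_self)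
    have hlinks : links x 0 (y :: L) = (x, y) :: links y 0 L := rfl
    rw [hlinks, List.forall_mem_cons, ih h0.2, List.isChain_cons_cons]
    simp [gridLinks, hy, Ne.symm h0.1]

theorem mem_orderings_iff {h m : ℕ} {L : List ℕ} :
    L ∈ orderings h m [(0, 1)] ↔ L.Perm (List.range' 1 m) ∧ L.head? = some 1 ∧
      L.IsChain fun x y => Follows h m x y ∨ Follows h m y x := by
  refine and_congr_right fun hperm => ?_
  have h0 : 0 ∉ L := fun hmem => by simpa using hperm.mem_iff.1 hmem
  cases L with
  | nil => simp [links]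
  | cons x L =>
    have hlinks : links 0 0 (x :: L) = (0, x) :: links x 0 L := rfl
    have hfst : (0, 1) ∉ links x 0 L := fun hmem => h0 <| by
      simpa only [map_fst_links] using List.mem_map_of_mem (f := Prod.fst) hmem
    have hforced : {e | e ∈ [(0, 1)]} ⊆ {e | e ∈ links 0 0 (x :: L)} ↔ x = 1 := by
      simp [hlinks, hfst, eq_comm]
    rw [hforced, List.head?_cons, Option.some_inj]
    refine and_congr_right ?_
    rintro rfl
    rw [← links_subset_gridLinks_iff h0, hlinks, Set.subset_def]
    exact List.forall_mem_cons.trans (and_iff_right (Or.inl (List.mem_singleton_self _)))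

theorem map_label_perm_iff {S : List (Fin (n + 1) × Fin (k + 1))} :
    (S.map label).Perm (List.range' 1 ((k + 1) * (n + 1))) ↔ S.Nodup ∧ ∀ v, v ∈ S := by
  have hmem (x : ℕ) : x ∈ List.range' 1 ((k + 1) * (n + 1)) ↔
      x ∈ Set.range (label (k := k) (n := n)) := by
    rw [range_label]
    rfl
  constructor
  · refine fun h => ⟨(h.nodup_iff.2 List.nodup_range').of_map label, fun v => ?_⟩
    exact (List.mem_map_of_injective label_injective).1
      (h.mem_iff.2 ((hmem _).2 (Set.mem_range_self v)))
  · rintro ⟨hS, hall⟩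
    refine (List.perm_ext_iff_of_nodup (hS.map label_injective) List.nodup_range').2 fun x => ?_
    simp [hmem, hall]

theorem map_label_mem_orderings_iff {S : List (Fin (n + 1) × Fin (k + 1))} :
    S.map label ∈ orderings (k + 1) ((k + 1) * (n + 1)) [(0, 1)] ↔
      (S.Nodup ∧ ∀ v, v ∈ S) ∧ S.head? = some (upperLeft k n) ∧
        S.IsChain (gridGraph (k + 1) (n + 1)).Adj := by
  have hhead : (S.map label).head? = some 1 ↔ S.head? = some (upperLeft k n) := by
    have h := (Option.map_injective label_injective).eq_iff (a := S.head?)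
      (b := some (upperLeft k n))
    rwa [Option.map_some, label_upperLeft, ← List.head?_map] at h
  have hadj : (gridGraph (k + 1) (n + 1)).Adj = fun v w =>
      Follows (k + 1) ((k + 1) * (n + 1)) (label v) (label w) ∨
        Follows (k + 1) ((k + 1) * (n + 1)) (label w) (label v) :=
    funext₂ fun _ _ => propext adj_iff_follows_label
  rw [mem_orderings_iff, map_label_perm_iff, hhead, List.isChain_map, hadj]

theorem bijOn_greekKeyTours (k n : ℕ) :
    Set.BijOn (fun p : Σ v, (gridGraph (k + 1) (n + 1)).Walk (upperLeft k n) v =>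
      p.2.support.map label) (greekKeyTours k n)
      (orderings (k + 1) ((k + 1) * (n + 1)) [(0, 1)]) := by
  refine ⟨?_, ?_, ?_⟩
  · rintro ⟨v, p⟩ ⟨⟨hp, -⟩, hall⟩
    refine map_label_mem_orderings_iff.2 ⟨⟨hp.support_nodup, hall⟩, ?_, p.isChain_adj_support⟩
    rw [← p.cons_tail_support, List.head?_cons]
  · rintro ⟨v, p⟩ - ⟨w, q⟩ - h
    have hsupport : p.support = q.support := List.map_injective_iff.2 label_injective h
    obtain rfl : v = w := by
      rw [← p.getLast_support, ← q.getLast_support]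
      simp only [hsupport]
    rw [Walk.ext_support hsupport]
  · intro L hL
    obtain ⟨S, rfl⟩ : L ∈ Set.range (List.map label) := by
      rw [Set.range_list_map, range_label]
      exact fun x hx => hL.1.mem_iff.1 hx
    obtain ⟨⟨hnodup, hall⟩, hhead, hchain⟩ := map_label_mem_orderings_iff.1 hL
    obtain ⟨S, rfl⟩ := List.head?_eq_some_iff.1 hhead
    obtain ⟨v, p, hp⟩ : ∃ v, ∃ p : (gridGraph (k + 1) (n + 1)).Walk (upperLeft k n) v,
        p.support = upperLeft k n :: S :=
      ⟨_, Walk.ofSupport _ (List.cons_ne_nil _ S) hchain, Walk.support_ofSupport _ hchain⟩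
    rw [← hp] at hnodup hall ⊢
    exact ⟨⟨v, p⟩, ⟨⟨(Walk.isPath_def p).2 hnodup, fun w _ => hall w⟩, hall⟩, rfl⟩

theorem tourCount_succ_succ (k n : ℕ) :
    tourCount (k + 1) (n + 1) = count (k + 1) ((k + 1) * (n + 1)) [(0, 1)] :=
  (bijOn_greekKeyTours k n).ncard_eq

end Tours

section GeneratingFunction

theorem tourCount_four {n : ℕ} (hn : n ≠ 0) : tourCount 4 n = count 4 (4 * n) [(0, 1)] := by
  obtain ⟨n, rfl⟩ := Nat.exists_eq_succ_of_ne_zero hn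
  exact tourCount_succ_succ 3 n

theorem cast_tourCount_four {n : ℕ} (h0 : n ≠ 0) (hn : n < firstCounts.length) :
    (tourCount 4 n : ℤ) = firstCounts[n] := by
  rw [tourCount_four h0, cast_count_four hn]

theorem tourCount_four_recurrence {n : ℕ} (hn : 10 ≤ n) :
    (tourCount 4 n : ℤ) = 3 * tourCount 4 (n - 1) + 3 * tourCount 4 (n - 2)
      - 9 * tourCount 4 (n - 3) - 6 * tourCount 4 (n - 4) + 5 * tourCount 4 (n - 5)
      + tourCount 4 (n - 6) - 3 * tourCount 4 (n - 7) + tourCount 4 (n - 8) := by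
  obtain ⟨m, rfl⟩ := Nat.exists_eq_add_of_le' hn
  have hrec := applyShift_recurrence_count_four m
  simp only [recurrence, applyShift, Nat.add_assoc, Nat.reduceAdd] at hrec
  simp only [Nat.reduceSubDiff, tourCount_four, ne_eq, Nat.add_eq_zero_iff, OfNat.ofNat_ne_zero,
    and_false, not_false_eq_true]
  linarith

open PowerSeries

theorem mul_denominator_eq (f : PowerSeries ℚ) :
    f * ((1 - X - 3 * X ^ 2 - X ^ 3 + X ^ 4) * (1 - 2 * X - 2 * X ^ 2 + 2 * X ^ 3 - X ^ 4)) =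
      f * X ^ 0 - (3 : ℚ) • (f * X ^ 1) - (3 : ℚ) • (f * X ^ 2) + (9 : ℚ) • (f * X ^ 3)
        + (6 : ℚ) • (f * X ^ 4) - (5 : ℚ) • (f * X ^ 5) - f * X ^ 6 + (3 : ℚ) • (f * X ^ 7)
        - f * X ^ 8 := by
  simp only [smul_eq_C_mul, map_ofNat]
  ring

theorem numerator_eq :
    (1 - 2 * X - 2 * X ^ 2 + 11 * X ^ 3 + 4 * X ^ 4 - 10 * X ^ 5 + 4 * X ^ 6 + 2 * X ^ 7
      - 3 * X ^ 8 + X ^ 9 : PowerSeries ℚ) =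
      X ^ 0 - (2 : ℚ) • X ^ 1 - (2 : ℚ) • X ^ 2 + (11 : ℚ) • X ^ 3 + (4 : ℚ) • X ^ 4
        - (10 : ℚ) • X ^ 5 + (4 : ℚ) • X ^ 6 + (2 : ℚ) • X ^ 7 - (3 : ℚ) • X ^ 8 + X ^ 9 := by
  simp only [smul_eq_C_mul, map_ofNat]
  ring

theorem genFun_four_mul_denominator :
    genFun 4 * ((1 - X - 3 * X ^ 2 - X ^ 3 + X ^ 4) *
      (1 - 2 * X - 2 * X ^ 2 + 2 * X ^ 3 - X ^ 4)) =
    1 - 2 * X - 2 * X ^ 2 + 11 * X ^ 3 + 4 * X ^ 4 - 10 * X ^ 5 + 4 * X ^ 6 + 2 * X ^ 7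
      - 3 * X ^ 8 + X ^ 9 := by
  rw [mul_denominator_eq, numerator_eq]
  ext n
  simp only [map_add, map_sub, map_smul, smul_eq_mul, coeff_mul_X_pow', coeff_X_pow, genFun,
    coeff_mk]
  obtain hn | hn := lt_or_ge n 10
  · have hzero : tourCount 4 0 = 1 := rfl
    have hvalue {i : ℕ} (hi0 : i ≠ 0) (hi : i < firstCounts.length) :
        (tourCount 4 i : ℚ) = (firstCounts[i] : ℤ) := by
      rw [← cast_tourCount_four hi0 hi, Int.cast_natCast]
    interval_cases n <;> norm_num [hzero, hvalue, firstCounts]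
  · have hrec := congrArg (Int.cast : ℤ → ℚ) (tourCount_four_recurrence hn)
    push_cast at hrec
    have hle (i : ℕ) (hi : i < 10) : i ≤ n := by omega
    have hne (i : ℕ) (hi : i < 10) : n ≠ i := by omega
    simp only [hle, hne, if_true, if_false, Nat.reduceLT, tsub_zero]
    linarith

end GeneratingFunction

end GreekKey

open PowerSeries in
theorem mainTheorem6 :
    GreekKey.genFun 4 =
      (1 - 2 * X - 2 * X ^ 2 + 11 * X ^ 3 + 4 * X ^ 4 - 10 * X ^ 5 + 4 * X ^ 6 + 2 * X ^ 7
          - 3 * X ^ 8 + X ^ 9) *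
        ((1 - X - 3 * X ^ 2 - X ^ 3 + X ^ 4) *
          (1 - 2 * X - 2 * X ^ 2 + 2 * X ^ 3 - X ^ 4) : PowerSeries ℚ)⁻¹ ∧
    ∀ n : ℕ, 10 ≤ n →
      (GreekKey.tourCount 4 n : ℤ) =
        3 * GreekKey.tourCount 4 (n - 1) + 3 * GreekKey.tourCount 4 (n - 2)
          - 9 * GreekKey.tourCount 4 (n - 3) - 6 * GreekKey.tourCount 4 (n - 4)
          + 5 * GreekKey.tourCount 4 (n - 5) + GreekKey.tourCount 4 (n - 6)
          - 3 * GreekKey.tourCount 4 (n - 7) + GreekKey.tourCount 4 (n - 8) := by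
  refine ⟨?_, fun n hn => GreekKey.tourCount_four_recurrence hn⟩
  rw [PowerSeries.eq_mul_inv_iff_mul_eq]
  · exact GreekKey.genFun_four_mul_denominator
  · simp
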